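/- Let $(S,\mathcal S)$ be a measurable space, $R$ a Markov (probability) kernel on $S$ and $U_0$ a probability measure on $S$. Consider the urn model with colours indexed by $S$, initial configuration $U_0$ and replacement kernel $R$: $(Z_n)_{n\ge 0}$ are $S$-valued random variables and $(U_n)_{n\ge 0}$ are random finite measures on $S$ with $$U_{n+1}(A)=U_n(A)+R(Z_n,A),\qquad \mathbb P\left(Z_n\in A\mid U_n,U_{n-1},\dots,U_0\right)=\frac{U_n(A)}{n+1}\quad\text{a.s.},\qquad A\in\mathcal S,\ n\ge 0,$$ so that $Z_n$ is the colour of the $(n+1)$-th draw. Let $(X_n)_{n\ge 0}$ be a Markov chain on $S$ with transition kernel $R$ and initial distribution $U_0$. Then, possibly after enlarging the probability space on which $(X_n)_{n\ge0}$ is defined, there exists a non-decreasing sequence $(\tau_n)_{n\ge 0}$ of random times with values in $\{0,1,2,\dots\}$ and $\tau_0=0$, such that 1. the sequence $(\tau_n)_{n\ge 0}$ is independent of the chain $(X_n)_{n\ge 0}$, and there is a filtration with respect to which every $\tau_n$ is a stopping time and $(X_n)_{n\ge0}$ is still a Markov chain with transition kernel $R$ and initial distribution $U_0$; 2. $Z_n\stackrel{d}{=}X_{\tau_n}$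 for every $n\ge 0$; 3. $\dfrac{\tau_n}{\log n}\longrightarrow 1$ almost surely as $n\to\infty$; 4. $\dfrac{\tau_n-\log n}{\sqrt{\log n}}\stackrel{d}{\longrightarrow}N(0,1)$ as $n\to\infty$. -/

import Mathlib

open MeasureTheory ProbabilityTheory Filter Topology

universe u

/-- The filtration generated by a sequence of random elements:
at time `n` it is the σ-algebra `σ(Y 0, …, Y n)`. -/
def historyFiltration {Ω α : Type*} [mΩ : MeasurableSpace Ω] [mα : MeasurableSpace α]
    (Y : ℕ → Ω → α) (hY : ∀ n, Measurable (Y n)) : Filtration ℕ mΩ where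
  seq n := ⨆ k ≤ n, mα.comap (Y k)
  mono' _ _ hmn := iSup₂_le fun k hk => le_iSup₂_of_le k (hk.trans hmn) le_rfl
  le' _ := iSup₂_le fun k _ => (hY k).comap_le

/-- The configuration of the urn with replacement kernel `R` and initial configuration `U₀`, when
the drawn colours are `Z 0, Z 1, …`:  `U 0 = U₀` and `U (n + 1) = U n + R (Z n, ·)`. -/
noncomputable def urnConfig {Ω S : Type*} [MeasurableSpace S]
    (R : Kernel S S) (U₀ : Measure S) (Z : ℕ → Ω → S) : ℕ → Ω → Measure S
  | 0, _ => U₀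
  | n + 1, ω => urnConfig R U₀ Z n ω + R (Z n ω)

theorem measurable_urnConfig {Ω S : Type*} [MeasurableSpace Ω] [MeasurableSpace S]
    (R : Kernel S S) (U₀ : Measure S) (Z : ℕ → Ω → S) (hZ : ∀ n, Measurable (Z n)) (n : ℕ) :
    Measurable (urnConfig R U₀ Z n) := by
  induction n with
  | zero => exact measurable_const
  | succ n ih =>
    refine Measure.measurable_of_measurable_coe _ fun A hA => ?_
    exact ((Measure.measurable_coe hA).comp ih).add
      ((Measure.measurable_coe hA).comp (R.measurable.comp (hZ n)))

/-- `Z` is the sequence of colours drawn from the urn with replacement kernel `R` and initial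
configuration `U₀`: writing `U n` for the configuration at time `n`,
`P (Z n ∈ A | U 0, …, U n) = U n (A) / (n + 1)` almost surely, for every measurable `A`. -/
structure IsUrnColourSequence {Ω S : Type*} [MeasurableSpace Ω] [MeasurableSpace S]
    (R : Kernel S S) (U₀ : Measure S) (P : Measure Ω) (Z : ℕ → Ω → S) : Prop where
  measurable : ∀ n, Measurable (Z n)
  condProb_draw : ∀ (n : ℕ) (A : Set S), MeasurableSet A →
    P⟦Z n ⁻¹' A |
        historyFiltration (urnConfig R U₀ Z) (measurable_urnConfig R U₀ Z measurable) n⟧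
      =ᵐ[P] fun ω => (urnConfig R U₀ Z n ω).real A / (n + 1)

/-- `X` is a Markov chain with respect to the filtration `ℱ`, with transition kernel `R` and
initial distribution `ν`. -/
structure IsMarkovChainWrt {Ω S : Type*} [mΩ : MeasurableSpace Ω] [MeasurableSpace S]
    (R : Kernel S S) (ν : Measure S) (P : Measure Ω) (ℱ : Filtration ℕ mΩ)
    (X : ℕ → Ω → S) : Prop where
  adapted : ∀ n, Measurable[ℱ n] (X n)
  map_zero : P.map (X 0) = ν
  condProb_step : ∀ (n : ℕ) (A : Set S), MeasurableSet A →
    P⟦X (n + 1) ⁻¹' A | ℱ n⟧ =ᵐ[P] fun ω => (R (X n ω)).real A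

/-- `X` is a Markov chain (with respect to its own history) with transition kernel `R` and
initial distribution `ν`. -/
structure IsMarkovChain {Ω S : Type*} [MeasurableSpace Ω] [MeasurableSpace S]
    (R : Kernel S S) (ν : Measure S) (P : Measure Ω) (X : ℕ → Ω → S) : Prop where
  measurable : ∀ n, Measurable (X n)
  markov : IsMarkovChainWrt R ν P (historyFiltration X measurable) X

/-! Taking expectations in the draw rule gives `(n + 1) P(Z n ∈ A) = E[U n (A)]`. If `μ n` is the
law of `Z n`, the replacement rule becomes `(n + 2) μ (n + 1) = (n + 1) μ n + μ n R`: with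
probability `1 / (n + 2)` take one step of the kernel, otherwise stay. So the clock is a sum of
independent Bernoulli variables of parameters `1 / (k + 2)`, `k < n`, independent of `X`; the law of
`X` at that time obeys the same recursion (`real_preimage_succ`, `real_preimage_comp_clock_succ`),
and both start from `U₀`.

The clock has mean `H (n + 1) - 1 = log n + O(1)` and variance at most its mean. Chebyshev-type
bounds along `2 ^ j ^ 2` and monotonicity give the strong law. For the central limit theorem, the
characteristic function `∏ (1 + p k z)` is compared with the Poisson one `exp ((∑ p k) z)`; the
error is at most `‖z‖ ^ 2` because `∑ p k ^ 2 ≤ 1`. -/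

/-! ### The clock with independent Bernoulli increments. -/

/-- The law of the `k`-th increment of the clock: Bernoulli with success probability
`1 / (k + 2)`. -/
noncomputable def stepLaw (k : ℕ) : Measure ℕ :=
  ENNReal.ofReal ((k + 1) / (k + 2)) • Measure.dirac 0
    + ENNReal.ofReal (1 / (k + 2)) • Measure.dirac 1

instance isProbabilityMeasure_stepLaw (k : ℕ) : IsProbabilityMeasure (stepLaw k) where
  measure_univ := by
    have : ((k : ℝ) + 1) / (k + 2) + 1 / (k + 2) = 1 := by field_simp; ring
    simp only [stepLaw, Measure.coe_add, Measure.coe_smul, Pi.add_apply, Pi.smul_apply,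
      measure_univ, smul_eq_mul, mul_one]
    rw [← ENNReal.ofReal_add (by positivity) (by positivity), this, ENNReal.ofReal_one]

theorem integrable_stepLaw {E : Type*} [NormedAddCommGroup E] (k : ℕ) (f : ℕ → E) :
    Integrable f (stepLaw k) :=
  ((integrable_dirac (by simp)).smul_measure ENNReal.ofReal_ne_top).add_measure
    ((integrable_dirac (by simp)).smul_measure ENNReal.ofReal_ne_top)

theorem integral_stepLaw {E : Type*} [NormedAddCommGroup E] [NormedSpace ℝ E] [CompleteSpace E]
    (k : ℕ) (f : ℕ → E) :
    ∫ x, f x ∂stepLaw k = (((k : ℝ) + 1) / (k + 2)) • f 0 + ((1 : ℝ) / (k + 2)) • f 1 := by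
  rw [stepLaw, integral_add_measure
    ((integrable_dirac (by simp)).smul_measure ENNReal.ofReal_ne_top)
    ((integrable_dirac (by simp)).smul_measure ENNReal.ofReal_ne_top),
    integral_smul_measure, integral_smul_measure, integral_dirac, integral_dirac,
    ENNReal.toReal_ofReal (by positivity), ENNReal.toReal_ofReal (by positivity)]

/-- The law of the sequence of independent increments of the clock. -/
noncomputable def stepSeqLaw : Measure (ℕ → ℕ) := Measure.infinitePi stepLaw

instance isProbabilityMeasure_stepSeqLaw : IsProbabilityMeasure stepSeqLaw := by
  unfold stepSeqLaw; infer_instance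

/-- The clock with increments `b 0, b 1, …`. -/
def clock (n : ℕ) (b : ℕ → ℕ) : ℕ := ∑ k ∈ Finset.range n, b k

theorem measurable_clock (n : ℕ) : Measurable (clock n) :=
  Finset.measurable_sum _ fun k _ => measurable_pi_apply k

theorem clock_succ (n : ℕ) (b : ℕ → ℕ) : clock (n + 1) b = clock n b + b n :=
  Finset.sum_range_succ _ _

theorem monotone_clock (b : ℕ → ℕ) : Monotone fun n => clock n b :=
  monotone_nat_of_le_succ fun n => by rw [clock_succ]; exact Nat.le_add_right _ _

theorem map_eval_stepSeqLaw (k : ℕ) : stepSeqLaw.map (fun b => b k) = stepLaw k :=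
  Measure.infinitePi_map_eval stepLaw k

theorem iIndepFun_eval_stepSeqLaw : iIndepFun (fun (k : ℕ) (b : ℕ → ℕ) => b k) stepSeqLaw :=
  iIndepFun_infinitePi (P := stepLaw) (X := fun _ => id) fun _ => measurable_id

/-- Condition on the last increment, which is independent of `clock n`. -/
theorem integral_clock_succ (n : ℕ) (g : ℕ → ℝ) (C : ℝ) (hg : ∀ k, ‖g k‖ ≤ C) :
    ∫ b, g (clock (n + 1) b) ∂stepSeqLaw =
      ((n : ℝ) + 1) / (n + 2) * ∫ b, g (clock n b) ∂stepSeqLaw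
        + 1 / (n + 2) * ∫ b, g (clock n b + 1) ∂stepSeqLaw := by
  have hind : IndepFun (clock n) (fun b : ℕ → ℕ => b n) stepSeqLaw := by
    have h := iIndepFun_eval_stepSeqLaw.indepFun_finsetSum_of_notMem
      (fun k => measurable_pi_apply k) (s := Finset.range n) (i := n) (by simp)
    convert h using 1
    ext b
    simp [clock]
  have hmap := (indepFun_iff_map_prod_eq_prod_map_map (measurable_clock n).aemeasurable
    (measurable_pi_apply n).aemeasurable).1 hind
  rw [map_eval_stepSeqLaw] at hmap
  have := Measure.isProbabilityMeasure_map (μ := stepSeqLaw) (measurable_clock n).aemeasurable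
  have hint (h : ℕ → ℝ) (hh : ∀ k, ‖h k‖ ≤ C) : Integrable (fun b => h (clock n b)) stepSeqLaw :=
    Integrable.of_bound (((measurable_of_countable h).comp (measurable_clock n)).aestronglyMeasurable)
      C (ae_of_all _ fun b => hh _)
  calc ∫ b, g (clock (n + 1) b) ∂stepSeqLaw
      = ∫ p : ℕ × ℕ, g (p.1 + p.2) ∂(stepSeqLaw.map fun b => (clock n b, b n)) := by
        rw [integral_map ((measurable_clock n).prodMk (measurable_pi_apply n)).aemeasurable
          (measurable_of_countable _).aestronglyMeasurable]
        simp only [clock_succ]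
    _ = ∫ c, ∫ x, g (c + x) ∂stepLaw n ∂(stepSeqLaw.map (clock n)) := by
        rw [hmap, integral_prod]
        exact Integrable.of_bound (measurable_of_countable _).aestronglyMeasurable C
          (ae_of_all _ fun p => hg _)
    _ = _ := by
        rw [integral_map (measurable_clock n).aemeasurable
          (measurable_of_countable _).aestronglyMeasurable]
        simp only [integral_stepLaw, smul_eq_mul, add_zero]
        rw [integral_add ((hint _ hg).const_mul _)
          ((hint (fun k => g (k + 1)) fun k => hg _).const_mul _),
          integral_const_mul, integral_const_mul]

/-! ### One-dimensional laws of the urn and of the time-changed chain. -/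

section Urn

variable {S : Type*} [MeasurableSpace S] {R : Kernel S S} {U₀ : Measure S}

theorem measurable_kernel_real (R : Kernel S S) {A : Set S} (hA : MeasurableSet A) :
    Measurable fun x => (R x).real A :=
  (R.measurable_coe hA).ennreal_toReal

theorem integrable_kernel_real [IsMarkovKernel R] {Ω : Type*} [MeasurableSpace Ω] {P : Measure Ω}
    [IsFiniteMeasure P] {Y : Ω → S} (hY : Measurable Y) {A : Set S} (hA : MeasurableSet A) :
    Integrable (fun ω => (R (Y ω)).real A) P :=
  Integrable.of_bound ((measurable_kernel_real R hA).comp hY).aestronglyMeasurable 1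
    (ae_of_all _ fun ω => by
      rw [Real.norm_of_nonneg measureReal_nonneg]; exact measureReal_le_one)

instance isFiniteMeasure_urnConfig [IsMarkovKernel R] [IsProbabilityMeasure U₀] {Ω : Type*} (Z : ℕ → Ω → S) (n : ℕ) (ω : Ω) :
    IsFiniteMeasure (urnConfig R U₀ Z n ω) := by
  induction n with
  | zero => unfold urnConfig; infer_instance
  | succ n ih => unfold urnConfig; infer_instance

theorem urnConfig_succ_real [IsMarkovKernel R] [IsProbabilityMeasure U₀] {Ω : Type*} (Z : ℕ → Ω → S) (n : ℕ) (ω : Ω) (A : Set S) :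
    (urnConfig R U₀ Z (n + 1) ω).real A =
      (urnConfig R U₀ Z n ω).real A + (R (Z n ω)).real A :=
  measureReal_add_apply

theorem integrable_urnConfig_real [IsMarkovKernel R] [IsProbabilityMeasure U₀] {Ω : Type*} [MeasurableSpace Ω] {P : Measure Ω}
    [IsFiniteMeasure P] {Z : ℕ → Ω → S} (hZ : ∀ n, Measurable (Z n)) {A : Set S}
    (hA : MeasurableSet A) (n : ℕ) :
    Integrable (fun ω => (urnConfig R U₀ Z n ω).real A) P := by
  induction n with
  | zero => exact integrable_const (U₀.real A)
  | succ n ih =>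
    simp only [urnConfig_succ_real]
    exact ih.add (integrable_kernel_real (hZ n) hA)

namespace IsUrnColourSequence

variable {Ω : Type*} [MeasurableSpace Ω] {P : Measure Ω} {Z : ℕ → Ω → S}

/-- A conditional probability integrates to the probability. Everything used later about the draw
rule passes through this identity. -/
theorem integral_urnConfig [IsProbabilityMeasure P] (hZ : IsUrnColourSequence R U₀ P Z) {A : Set S} (hA : MeasurableSet A)
    (n : ℕ) :
    ∫ ω, (urnConfig R U₀ Z n ω).real A ∂P = (n + 1) * P.real (Z n ⁻¹' A) := by
  have hle := (historyFiltration (urnConfig R U₀ Z)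
    (measurable_urnConfig R U₀ Z hZ.measurable)).le n
  have h := integral_condExp (μ := P) (f := (Z n ⁻¹' A).indicator fun _ => (1 : ℝ)) hle
  rw [integral_congr_ae (hZ.condProb_draw n A hA), integral_div,
    integral_indicator_const _ (hZ.measurable n hA), smul_eq_mul, mul_one] at h
  rw [← h]
  field_simp

theorem real_preimage_zero [IsProbabilityMeasure P] [IsProbabilityMeasure U₀] (hZ : IsUrnColourSequence R U₀ P Z) {A : Set S}
    (hA : MeasurableSet A) : P.real (Z 0 ⁻¹' A) = U₀.real A := by
  simpa [urnConfig] using (hZ.integral_urnConfig hA 0).symm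

theorem real_preimage_succ [IsMarkovKernel R] [IsProbabilityMeasure U₀] [IsProbabilityMeasure P]
    (hZ : IsUrnColourSequence R U₀ P Z) {A : Set S}
    (hA : MeasurableSet A) (n : ℕ) :
    P.real (Z (n + 1) ⁻¹' A) = ((n : ℝ) + 1) / (n + 2) * P.real (Z n ⁻¹' A)
      + 1 / (n + 2) * ∫ ω, (R (Z n ω)).real A ∂P := by
  have h := hZ.integral_urnConfig hA (n + 1)
  simp only [urnConfig_succ_real] at h
  rw [integral_add (integrable_urnConfig_real hZ.measurable hA n)
    (integrable_kernel_real (hZ.measurable n) hA), hZ.integral_urnConfig hA n] at h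
  push_cast at h
  field_simp
  linarith

end IsUrnColourSequence

namespace IsMarkovChain

variable {Ω : Type*} [MeasurableSpace Ω] {P : Measure Ω} {X : ℕ → Ω → S}

theorem real_preimage_succ [IsProbabilityMeasure P] (hX : IsMarkovChain R U₀ P X) {A : Set S} (hA : MeasurableSet A)
    (n : ℕ) : P.real (X (n + 1) ⁻¹' A) = ∫ ω, (R (X n ω)).real A ∂P := by
  have hle := (historyFiltration X hX.measurable).le n
  have h := integral_condExp (μ := P) (f := (X (n + 1) ⁻¹' A).indicator fun _ => (1 : ℝ)) hle
  rw [integral_congr_ae (hX.markov.condProb_step n A hA),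
    integral_indicator_const _ (hX.measurable _ hA), smul_eq_mul, mul_one] at h
  exact h.symm

theorem measurable_comp_clock (hX : IsMarkovChain R U₀ P X) (n : ℕ) :
    Measurable fun p : Ω × (ℕ → ℕ) => X (clock n p.2) p.1 :=
  measurable_from_prod_countable_left (f := fun q : Ω × ℕ => X q.2 q.1)
    (fun k => hX.measurable k) |>.comp
      (measurable_fst.prodMk ((measurable_clock n).comp measurable_snd))

theorem integral_comp_clock [IsProbabilityMeasure P] (hX : IsMarkovChain R U₀ P X) (n : ℕ) {g : S → ℝ} (hg : Measurable g)
    {C : ℝ} (hC : ∀ x, ‖g x‖ ≤ C) :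
    ∫ p, g (X (clock n p.2) p.1) ∂(P.prod stepSeqLaw) =
      ∫ b, ∫ ω, g (X (clock n b) ω) ∂P ∂stepSeqLaw :=
  integral_prod_symm _ (Integrable.of_bound
    (hg.comp (hX.measurable_comp_clock n)).aestronglyMeasurable C (ae_of_all _ fun _ => hC _))

theorem real_preimage_comp_clock [IsProbabilityMeasure P] (hX : IsMarkovChain R U₀ P X) (n : ℕ) {A : Set S}
    (hA : MeasurableSet A) :
    (P.prod stepSeqLaw).real ((fun p => X (clock n p.2) p.1) ⁻¹' A) =
      ∫ b, P.real (X (clock n b) ⁻¹' A) ∂stepSeqLaw := by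
  have h := hX.integral_comp_clock n (g := A.indicator fun _ => (1 : ℝ))
    (measurable_const.indicator hA) (C := 1) fun x => by
      by_cases hx : x ∈ A <;> simp [hx]
  have e {Ω' : Type _} [MeasurableSpace Ω'] (μ : Measure Ω') {Y : Ω' → S} (hY : Measurable Y) :
      ∫ ω, A.indicator (fun _ => (1 : ℝ)) (Y ω) ∂μ = μ.real (Y ⁻¹' A) := by
    have : (fun ω => A.indicator (fun _ => (1 : ℝ)) (Y ω)) =
      (Y ⁻¹' A).indicator fun _ => (1 : ℝ) := rfl
    rw [this, integral_indicator_const _ (hY hA), smul_eq_mul, mul_one]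
  rw [e _ (hX.measurable_comp_clock n)] at h
  rw [h]
  exact integral_congr_ae (ae_of_all _ fun b => e P (hX.measurable _))

/-- Freezing the clock by Fubini reduces this to deterministic times, where advancing by one applies
`R` once. The coefficients match the urn recursion. -/
theorem real_preimage_comp_clock_succ [IsMarkovKernel R] [IsProbabilityMeasure P]
    (hX : IsMarkovChain R U₀ P X) (n : ℕ) {A : Set S}
    (hA : MeasurableSet A) :
    (P.prod stepSeqLaw).real ((fun p => X (clock (n + 1) p.2) p.1) ⁻¹' A) =
      ((n : ℝ) + 1) / (n + 2) *
          (P.prod stepSeqLaw).real ((fun p => X (clock n p.2) p.1) ⁻¹' A)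
        + 1 / (n + 2) * ∫ p, (R (X (clock n p.2) p.1)).real A ∂(P.prod stepSeqLaw) := by
  rw [hX.real_preimage_comp_clock _ hA, hX.real_preimage_comp_clock _ hA,
    integral_clock_succ n (fun k => P.real (X k ⁻¹' A)) 1 fun k => by
      rw [Real.norm_of_nonneg measureReal_nonneg]; exact measureReal_le_one,
    hX.integral_comp_clock n (measurable_kernel_real R hA) (C := 1) fun x => by
      rw [Real.norm_of_nonneg measureReal_nonneg]; exact measureReal_le_one]
  simp only [hX.real_preimage_succ hA]

/-- The `n`-th colour drawn from the urn is distributed as the chain at the time `clock n`. -/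
theorem identDistrib_comp_clock [IsMarkovKernel R] [IsProbabilityMeasure U₀] [IsProbabilityMeasure P]
    (hX : IsMarkovChain R U₀ P X) {ΩZ : Type*} [MeasurableSpace ΩZ]
    {PZ : Measure ΩZ} [IsProbabilityMeasure PZ] {Z : ℕ → ΩZ → S}
    (hZ : IsUrnColourSequence R U₀ PZ Z) (n : ℕ) :
    IdentDistrib (Z n) (fun p : Ω × (ℕ → ℕ) => X (clock n p.2) p.1) PZ (P.prod stepSeqLaw) := by
  have hreal (n : ℕ) (h : ∀ A, MeasurableSet A → PZ.real (Z n ⁻¹' A) =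
      (P.prod stepSeqLaw).real ((fun p => X (clock n p.2) p.1) ⁻¹' A)) :
      IdentDistrib (Z n) (fun p : Ω × (ℕ → ℕ) => X (clock n p.2) p.1) PZ (P.prod stepSeqLaw) := by
    refine ⟨(hZ.measurable n).aemeasurable, (hX.measurable_comp_clock n).aemeasurable, ?_⟩
    refine Measure.ext fun A hA => ?_
    rw [Measure.map_apply (hZ.measurable n) hA,
      Measure.map_apply (hX.measurable_comp_clock n) hA]
    exact (measureReal_eq_measureReal_iff).1 (h A hA)
  -- The induction carries the whole law, not the mass of one set `A`: the recursion integrates `x ↦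
  -- R x A` against the law at the previous time.
  induction n with
  | zero =>
    refine hreal 0 fun A hA => ?_
    rw [hZ.real_preimage_zero hA, hX.real_preimage_comp_clock 0 hA]
    simp only [clock, Finset.range_zero, Finset.sum_empty, integral_const, probReal_univ, one_smul]
    rw [← hX.markov.map_zero, map_measureReal_apply (hX.measurable 0) hA]
  | succ n ih =>
    refine hreal (n + 1) fun A hA => ?_
    rw [hZ.real_preimage_succ hA, hX.real_preimage_comp_clock_succ n hA]
    congr 2
    · simp only [measureReal_def]
      rw [ih.measure_mem_eq hA]
    · exact (ih.comp (measurable_kernel_real R hA)).integral_eq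

/-- Adjoining an independent σ-algebra to the history of a Markov chain from the start keeps it
a Markov chain. -/
theorem isMarkovChainWrt_prod [IsMarkovKernel R] [IsProbabilityMeasure P]
    (hX : IsMarkovChain R U₀ P X) {T : Type*} [mT : MeasurableSpace T]
    (Q : Measure T) [IsProbabilityMeasure Q]
    (𝒢 : Filtration ℕ (inferInstance : MeasurableSpace (Ω × T)))
    (h𝒢 : ∀ n, 𝒢 n = (historyFiltration X hX.measurable n).prod mT) :
    IsMarkovChainWrt R U₀ (P.prod Q) 𝒢 (fun k p => X k p.1) where
  adapted n := by
    rw [h𝒢]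
    exact (hX.markov.adapted n).comp (@measurable_fst _ _ (historyFiltration X hX.measurable n) mT)
  map_zero := by
    have := Measure.map_map (μ := P.prod Q) (hX.measurable 0) measurable_fst
    rw [(measurePreserving_fst (μ := P) (ν := Q)).map_eq, hX.markov.map_zero] at this
    exact this.symm
  condProb_step n A hA := by
    have hmeas : Measurable fun p : Ω × T => X (n + 1) p.1 :=
      (hX.measurable (n + 1)).comp measurable_fst
    have hadapt : Measurable[𝒢 n] fun p : Ω × T => X n p.1 := by
      rw [h𝒢]
      exact (hX.markov.adapted n).comp
        (@measurable_fst _ _ (historyFiltration X hX.measurable n) mT)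
    have hR : Integrable (fun p : Ω × T => (R (X n p.1)).real A) (P.prod Q) :=
      integrable_kernel_real ((hX.measurable n).comp measurable_fst) hA
    have h1 : Integrable (((fun p : Ω × T => X (n + 1) p.1) ⁻¹' A).indicator
        fun _ => (1 : ℝ)) (P.prod Q) := (integrable_const _).indicator (hmeas hA)
    refine (ae_eq_condExp_of_forall_setIntegral_eq (𝒢.le n) h1 (fun s _ _ => hR.integrableOn)
      (fun s hs _ => ?_) ?_).symm
    · have hs' : MeasurableSet s := 𝒢.le n s hs
      -- Each section of `s` at fixed `t` belongs to the history of `X`, so the Markov property on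
      -- `Ω` applies section by section and is then integrated over `t`.
      have hsec (t : T) : MeasurableSet[historyFiltration X hX.measurable n]
          {ω | (ω, t) ∈ s} := by
        rw [h𝒢] at hs
        exact (@measurable_prodMk_right _ _ (historyFiltration X hX.measurable n) mT t) hs
      rw [← integral_indicator hs', ← integral_indicator hs',
        integral_prod_symm _ (hR.indicator hs'), integral_prod_symm _ (h1.indicator hs')]
      refine integral_congr_ae (ae_of_all _ fun t => ?_)
      have hle := (historyFiltration X hX.measurable).le n
      have key : ∫ ω in {ω | (ω, t) ∈ s}, (R (X n ω)).real A ∂P =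
          ∫ ω in {ω | (ω, t) ∈ s}, (X (n + 1) ⁻¹' A).indicator (fun _ => (1 : ℝ)) ω ∂P := by
        rw [← setIntegral_condExp hle
          ((integrable_const (1 : ℝ)).indicator (hX.measurable (n + 1) hA)) (hsec t)]
        exact setIntegral_congr_ae (hle _ (hsec t))
          ((hX.markov.condProb_step n A hA).mono fun ω hω _ => hω.symm)
      rw [← integral_indicator (hle _ (hsec t)), ← integral_indicator (hle _ (hsec t))] at key
      exact key
    · exact ((measurable_kernel_real R hA).comp hadapt).aestronglyMeasurable

end IsMarkovChain

end Urn

/-! ### Moments of the clock and the strong law. -/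

/-- The mean of `clock n`. -/
noncomputable def clockMean (n : ℕ) : ℝ := ∑ k ∈ Finset.range n, 1 / ((k : ℝ) + 2)

theorem clockMean_eq_harmonic (n : ℕ) : clockMean n = harmonic (n + 1) - 1 := by
  induction n with
  | zero => simp [clockMean, harmonic_succ]
  | succ n ih =>
    rw [clockMean, Finset.sum_range_succ, ← clockMean, ih, harmonic_succ (n + 1)]
    push_cast
    ring

theorem clockMean_nonneg (n : ℕ) : 0 ≤ clockMean n :=
  Finset.sum_nonneg fun k _ => by positivity

theorem clockMean_le (n : ℕ) : clockMean n ≤ 1 + Real.log n := by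
  have h := harmonic_le_one_add_log n
  rw [clockMean_eq_harmonic, harmonic_succ]
  push_cast
  have : ((n : ℝ) + 1)⁻¹ ≤ 1 := inv_le_one_of_one_le₀ (by linarith [Nat.cast_nonneg (α := ℝ) n])
  linarith

theorem tendsto_clockMean_sub_log :
    Tendsto (fun n : ℕ => clockMean n - Real.log n) atTop
      (𝓝 (Real.eulerMascheroniConstant - 1)) := by
  have h := (Real.tendsto_harmonic_sub_log.add
    (tendsto_one_div_add_atTop_nhds_zero_nat (𝕜 := ℝ))).sub_const 1
  rw [add_zero] at h
  refine h.congr fun n => ?_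
  rw [clockMean_eq_harmonic, harmonic_succ]
  push_cast
  rw [one_div]
  ring

theorem tendsto_log_natCast : Tendsto (fun n : ℕ => Real.log n) atTop atTop :=
  Real.tendsto_log_atTop.comp tendsto_natCast_atTop_atTop

theorem tendsto_clockMean_div_log :
    Tendsto (fun n : ℕ => clockMean n / Real.log n) atTop (𝓝 1) := by
  have h := (tendsto_clockMean_sub_log.div_atTop tendsto_log_natCast).add_const 1
  rw [zero_add] at h
  refine h.congr' ?_
  filter_upwards [tendsto_log_natCast.eventually_gt_atTop 0] with n hn
  field_simp
  ring

theorem memLp_eval_stepSeqLaw (k : ℕ) :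
    MemLp (fun b : ℕ → ℕ => (b k : ℝ)) 2 stepSeqLaw := by
  have h : MemLp (fun x : ℕ => (x : ℝ)) 2 (stepSeqLaw.map fun b => b k) := by
    rw [map_eval_stepSeqLaw,
      memLp_two_iff_integrable_sq (measurable_of_countable _).aestronglyMeasurable]
    exact integrable_stepLaw _ _
  exact h.comp_of_map (measurable_pi_apply k).aemeasurable

theorem integral_eval_stepSeqLaw {E : Type*} [NormedAddCommGroup E] [NormedSpace ℝ E]
    [CompleteSpace E] (k : ℕ) (f : ℕ → E) :
    ∫ b, f (b k) ∂stepSeqLaw =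
      (((k : ℝ) + 1) / (k + 2)) • f 0 + ((1 : ℝ) / (k + 2)) • f 1 := by
  rw [← integral_stepLaw, ← map_eval_stepSeqLaw, integral_map (measurable_pi_apply k).aemeasurable]
  have := integrable_stepLaw k f
  rw [map_eval_stepSeqLaw]
  exact this.aestronglyMeasurable

theorem integral_clock (n : ℕ) : ∫ b, (clock n b : ℝ) ∂stepSeqLaw = clockMean n := by
  simp only [clock, Nat.cast_sum, clockMean]
  rw [integral_finsetSum _ fun k _ => (memLp_eval_stepSeqLaw k).integrable one_le_two]
  refine Finset.sum_congr rfl fun k _ => ?_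
  rw [integral_eval_stepSeqLaw k (fun x => (x : ℝ))]
  simp

theorem memLp_clock (n : ℕ) : MemLp (fun b => (clock n b : ℝ)) 2 stepSeqLaw := by
  simp only [clock, Nat.cast_sum]
  exact memLp_finsetSum _ fun k _ => memLp_eval_stepSeqLaw k

/-- Variances of independent increments add, and a variable `b` with values in `{0, 1}` has `Var b ≤
E[b ^ 2] = E[b]`. -/
theorem variance_clock_le (n : ℕ) :
    variance (fun b => (clock n b : ℝ)) stepSeqLaw ≤ clockMean n := by
  have e : (fun b => (clock n b : ℝ)) =
      ∑ k ∈ Finset.range n, fun b : ℕ → ℕ => (b k : ℝ) := by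
    ext b; simp [clock]
  rw [e, IndepFun.variance_sum (fun k _ => memLp_eval_stepSeqLaw k) fun i _ j _ hij =>
    (iIndepFun_eval_stepSeqLaw.indepFun hij).comp (measurable_of_countable (fun x : ℕ => (x : ℝ)))
      (measurable_of_countable (fun x : ℕ => (x : ℝ)))]
  refine Finset.sum_le_sum fun k _ => ?_
  refine (variance_le_expectation_sq (memLp_eval_stepSeqLaw k).aestronglyMeasurable).trans ?_
  have := integral_eval_stepSeqLaw k (fun x => (x : ℝ) ^ 2)
  simp only [Pi.pow_apply, this]
  simp

theorem lintegral_clock_sub_clockMean_sq_le (n : ℕ) :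
    ∫⁻ b, ENNReal.ofReal (((clock n b : ℝ) - clockMean n) ^ 2) ∂stepSeqLaw
      ≤ ENNReal.ofReal (clockMean n) := by
  have h := evariance_eq_lintegral_ofReal (fun b => (clock n b : ℝ)) stepSeqLaw
  rw [integral_clock, ← ofReal_variance (memLp_clock n)] at h
  rw [← h]
  exact ENNReal.ofReal_le_ofReal (variance_clock_le n)

theorem log_two_pow_sq (j : ℕ) : Real.log ((2 ^ j ^ 2 : ℕ) : ℝ) = (j : ℝ) ^ 2 * Real.log 2 := by
  push_cast
  rw [Real.log_pow]
  push_cast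
  rfl

/-- Mean and logarithm are both of order `j ^ 2` along `2 ^ j ^ 2`, so the terms are `O(1 / j ^ 2)`.
At `j = 0` both sides of the comparison vanish, by division by zero. -/
theorem summable_clockMean_div_sq :
    Summable fun j : ℕ => clockMean (2 ^ j ^ 2) / Real.log ((2 ^ j ^ 2 : ℕ) : ℝ) ^ 2 := by
  refine Summable.of_nonneg_of_le (fun j => div_nonneg (clockMean_nonneg _) (sq_nonneg _))
    (fun j => ?_) ((Real.summable_one_div_nat_pow.2 one_lt_two).mul_left
      ((1 + Real.log 2) / Real.log 2 ^ 2))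
  have hm := clockMean_le (2 ^ j ^ 2)
  rw [log_two_pow_sq] at hm ⊢
  have h2 : 0 < Real.log 2 := Real.log_pos one_lt_two
  rcases Nat.eq_zero_or_pos j with rfl | hj
  · simp
  have hj' : (1 : ℝ) ≤ j := by exact_mod_cast hj
  have : clockMean (2 ^ j ^ 2) ≤ (1 + Real.log 2) * (j : ℝ) ^ 2 := by nlinarith
  calc clockMean (2 ^ j ^ 2) / ((j : ℝ) ^ 2 * Real.log 2) ^ 2
      ≤ (1 + Real.log 2) * (j : ℝ) ^ 2 / ((j : ℝ) ^ 2 * Real.log 2) ^ 2 := by gcongr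
    _ = _ := by field_simp

/-- The squared normalised deviations have summable expectations, so their sum is almost surely
finite and its terms tend to `0`. -/
theorem ae_tendsto_clock_two_pow_sq :
    ∀ᵐ b ∂stepSeqLaw, Tendsto
      (fun j : ℕ => (clock (2 ^ j ^ 2) b : ℝ) / Real.log ((2 ^ j ^ 2 : ℕ) : ℝ)) atTop (𝓝 1) := by
  set N : ℕ → ℕ := fun j => 2 ^ j ^ 2 with hN
  have hNtop : Tendsto N atTop atTop :=
    (tendsto_pow_atTop_atTop_of_one_lt one_lt_two).comp (tendsto_pow_atTop two_ne_zero)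
  let D : ℕ → (ℕ → ℕ) → ℝ := fun j b => ((clock (N j) b : ℝ) - clockMean (N j)) / Real.log (N j)
  have hmeas (j : ℕ) : Measurable fun b => ENNReal.ofReal (D j b ^ 2) :=
    (measurable_of_countable (fun c : ℕ => ENNReal.ofReal
      ((((c : ℝ) - clockMean (N j)) / Real.log (N j)) ^ 2))).comp (measurable_clock (N j))
  have hD (j : ℕ) : ∫⁻ b, ENNReal.ofReal (D j b ^ 2) ∂stepSeqLaw ≤
      ENNReal.ofReal (clockMean (N j) / Real.log (N j) ^ 2) := by
    have e (b : ℕ → ℕ) : ENNReal.ofReal (D j b ^ 2) = ENNReal.ofReal (1 / Real.log (N j) ^ 2) *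
        ENNReal.ofReal (((clock (N j) b : ℝ) - clockMean (N j)) ^ 2) := by
      rw [← ENNReal.ofReal_mul (by positivity)]
      congr 1
      simp only [D]
      ring
    simp only [e]
    rw [lintegral_const_mul' _ _ ENNReal.ofReal_ne_top]
    refine (mul_le_mul_right (lintegral_clock_sub_clockMean_sq_le (N j)) _).trans ?_
    rw [← ENNReal.ofReal_mul (by positivity)]
    exact (congrArg ENNReal.ofReal (by ring)).le
  have hfin : ∫⁻ b, ∑' j, ENNReal.ofReal (D j b ^ 2) ∂stepSeqLaw ≠ ⊤ := by
    rw [lintegral_tsum fun j => (hmeas j).aemeasurable]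
    exact ne_top_of_le_ne_top summable_clockMean_div_sq.tsum_ofReal_ne_top
      (ENNReal.tsum_le_tsum hD)
  filter_upwards [ae_lt_top (Measurable.tsum hmeas) hfin] with b hb
  have h0 : Tendsto (fun j => D j b) atTop (𝓝 0) := by
    have h1 := (ENNReal.tendsto_toReal ENNReal.zero_ne_top).comp
      (ENNReal.tendsto_atTop_zero_of_tsum_ne_top hb.ne)
    have h2 : Tendsto (fun j => D j b ^ 2) atTop (𝓝 0) :=
      h1.congr fun j => ENNReal.toReal_ofReal (sq_nonneg _)
    have h3 := h2.sqrt
    rw [Real.sqrt_zero] at h3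
    simp only [Real.sqrt_sq_eq_abs] at h3
    exact (tendsto_zero_iff_abs_tendsto_zero _).2 h3
  have h := h0.add (tendsto_clockMean_div_log.comp hNtop)
  rw [zero_add] at h
  refine h.congr fun j => ?_
  simp only [D, Function.comp]
  ring

/-- Consecutive logarithms along `2 ^ j ^ 2` have ratio tending to `1`, so monotonicity fills the
gaps. -/
theorem tendsto_div_log_of_tendsto_two_pow_sq {u : ℕ → ℝ} (hu : Monotone u) (hu0 : 0 ≤ u 0)
    (h : Tendsto (fun j : ℕ => u (2 ^ j ^ 2) / Real.log ((2 ^ j ^ 2 : ℕ) : ℝ)) atTop (𝓝 1)) :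
    Tendsto (fun n : ℕ => u n / Real.log n) atTop (𝓝 1) := by
  have hpos (n : ℕ) : 0 ≤ u n := hu0.trans (hu (Nat.zero_le n))
  have h2 : 0 < Real.log 2 := Real.log_pos one_lt_two
  have hratio : Tendsto (fun j : ℕ => ((j : ℝ) / (j + 1)) ^ 2) atTop (𝓝 1) := by
    simpa using (tendsto_natCast_div_add_atTop (1 : ℝ)).pow 2
  have hlow : Tendsto (fun j : ℕ => u (2 ^ j ^ 2) / Real.log ((2 ^ (j + 1) ^ 2 : ℕ) : ℝ))
      atTop (𝓝 1) := by
    have := h.mul hratio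
    rw [one_mul] at this
    refine this.congr' ?_
    filter_upwards [eventually_gt_atTop 0] with j hj
    have : (0 : ℝ) < j := by exact_mod_cast hj
    rw [log_two_pow_sq, log_two_pow_sq]
    push_cast
    field_simp
  have hupp : Tendsto (fun j : ℕ => u (2 ^ (j + 1) ^ 2) / Real.log ((2 ^ j ^ 2 : ℕ) : ℝ))
      atTop (𝓝 1) := by
    have := (h.comp (tendsto_add_atTop_nat 1)).div hratio one_ne_zero
    rw [div_one] at this
    refine this.congr' ?_
    filter_upwards [eventually_gt_atTop 0] with j hj
    have : (0 : ℝ) < j := by exact_mod_cast hj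
    simp only [Function.comp, Pi.div_apply]
    rw [log_two_pow_sq, log_two_pow_sq]
    push_cast
    field_simp
  -- For `n ≥ 1` this is the largest `j` with `2 ^ j ^ 2 ≤ n`.
  let J : ℕ → ℕ := fun n => Nat.sqrt (Nat.log 2 n)
  have hJ : Tendsto J atTop atTop := by
    refine tendsto_atTop.2 fun k => ?_
    filter_upwards [eventually_ge_atTop (2 ^ k ^ 2)] with n hn
    exact Nat.le_sqrt'.2 (Nat.le_log_of_pow_le one_lt_two hn)
  have hJ0 := hJ.eventually_gt_atTop 0
  have hle : ∀ᶠ n in atTop, 2 ^ J n ^ 2 ≤ n := by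
    filter_upwards [eventually_gt_atTop 0] with n hn
    exact Nat.pow_le_of_le_log hn.ne' (Nat.sqrt_le' _)
  have hge (n : ℕ) : n ≤ 2 ^ (J n + 1) ^ 2 :=
    (Nat.lt_pow_of_log_lt one_lt_two (Nat.lt_succ_sqrt' _)).le
  refine tendsto_of_tendsto_of_tendsto_of_le_of_le' (hlow.comp hJ) (hupp.comp hJ) ?_ ?_
  · filter_upwards [hJ0, hle] with n h1 h3
    have hn : (1 : ℝ) < n := by
      have : 2 ≤ n := le_trans (Nat.le_self_pow (by positivity) 2) h3
      exact_mod_cast this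
    have := hge n
    simp only [Function.comp]
    exact div_le_div₀ (hpos _) (hu h3) (Real.log_pos hn)
      (Real.log_le_log (by linarith) (by exact_mod_cast this))
  · filter_upwards [hJ0, hle] with n h1 h3
    simp only [Function.comp]
    have hp : 1 < 2 ^ J n ^ 2 := Nat.one_lt_pow (by positivity) one_lt_two
    exact div_le_div₀ (hpos _) (hu (hge n)) (Real.log_pos (by exact_mod_cast hp))
      (Real.log_le_log (by positivity) (by exact_mod_cast h3))

theorem ae_tendsto_clock_div_log :
    ∀ᵐ b ∂stepSeqLaw, Tendsto (fun n : ℕ => (clock n b : ℝ) / Real.log n) atTop (𝓝 1) := by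
  filter_upwards [ae_tendsto_clock_two_pow_sq] with b hb
  exact tendsto_div_log_of_tendsto_two_pow_sq
    (fun _ _ h => Nat.cast_le.2 (monotone_clock b h)) (Nat.cast_nonneg _) hb

/-! ### The central limit theorem by characteristic functions. -/

theorem norm_one_add_mul_le_one {p : ℝ} (hp0 : 0 ≤ p) (hp1 : p ≤ 1) {z : ℂ} (hz : ‖1 + z‖ ≤ 1) :
    ‖1 + (p : ℂ) * z‖ ≤ 1 := by
  have e : 1 + (p : ℂ) * z = ((1 - p : ℝ) : ℂ) + (p : ℂ) * (1 + z) := by push_cast; ring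
  rw [e]
  refine (norm_add_le _ _).trans ?_
  rw [norm_mul, Complex.norm_real, Complex.norm_real, Real.norm_of_nonneg (by linarith),
    Real.norm_of_nonneg hp0]
  nlinarith

/-- The hypothesis on `1 + z` forces `Re z ≤ 0`. -/
theorem norm_exp_mul_le_one {p : ℝ} (hp0 : 0 ≤ p) {z : ℂ} (hz : ‖1 + z‖ ≤ 1) :
    ‖Complex.exp ((p : ℂ) * z)‖ ≤ 1 := by
  have h := (Complex.abs_re_le_norm _).trans hz
  rw [abs_le, Complex.add_re, Complex.one_re] at h
  rw [Complex.norm_exp, Real.exp_le_one_iff, Complex.re_ofReal_mul]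
  nlinarith

/-- A product of factors `1 + p k z` compared with the exponential of `(∑ p k) z`. -/
theorem norm_prod_one_add_sub_exp_le {p : ℕ → ℝ} (hp0 : ∀ k, 0 ≤ p k) (hp1 : ∀ k, p k ≤ 1)
    {z : ℂ} (hz : ‖1 + z‖ ≤ 1) (hz1 : ‖z‖ ≤ 1) (n : ℕ) :
    ‖∏ k ∈ Finset.range n, (1 + (p k : ℂ) * z)
        - Complex.exp (((∑ k ∈ Finset.range n, p k : ℝ) : ℂ) * z)‖
      ≤ (∑ k ∈ Finset.range n, p k ^ 2) * ‖z‖ ^ 2 := by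
  induction n with
  | zero => simp
  | succ n ih =>
    rw [Finset.prod_range_succ, Finset.sum_range_succ, Finset.sum_range_succ, Complex.ofReal_add,
      add_mul, Complex.exp_add, add_mul]
    set A := ∏ k ∈ Finset.range n, (1 + (p k : ℂ) * z)
    set B := Complex.exp (((∑ k ∈ Finset.range n, p k : ℝ) : ℂ) * z)
    -- Factors are exchanged one at a time. Multipliers have norm at most `1`, so the errors `p n ^
    -- 2 * ‖z‖ ^ 2` simply add.
    have e : A * (1 + (p n : ℂ) * z) - B * Complex.exp ((p n : ℂ) * z) =
        (A - B) * (1 + (p n : ℂ) * z)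
          - B * (Complex.exp ((p n : ℂ) * z) - 1 - (p n : ℂ) * z) := by ring
    have hB : ‖B‖ ≤ 1 := norm_exp_mul_le_one (Finset.sum_nonneg fun k _ => hp0 k) hz
    have hpz : ‖(p n : ℂ) * z‖ = p n * ‖z‖ := by
      rw [norm_mul, Complex.norm_real, Real.norm_of_nonneg (hp0 n)]
    have hE : ‖Complex.exp ((p n : ℂ) * z) - 1 - (p n : ℂ) * z‖ ≤ p n ^ 2 * ‖z‖ ^ 2 := by
      have := Complex.norm_exp_sub_one_sub_id_le (x := (p n : ℂ) * z)
        (by rw [hpz]; exact mul_le_one₀ (hp1 n) (norm_nonneg _) hz1)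
      rwa [hpz, mul_pow] at this
    rw [e]
    refine (norm_sub_le _ _).trans (add_le_add ?_ ?_)
    · rw [norm_mul]
      exact (mul_le_of_le_one_right (norm_nonneg _)
        (norm_one_add_mul_le_one (hp0 n) (hp1 n) hz)).trans ih
    · rw [norm_mul]
      exact (mul_le_of_le_one_left (norm_nonneg _) hB).trans hE

theorem charFun_map_eval (k : ℕ) (θ : ℝ) :
    charFun (stepSeqLaw.map fun b => (b k : ℝ)) θ =
      1 + ((1 / ((k : ℝ) + 2) : ℝ) : ℂ) * (Complex.exp (θ * Complex.I) - 1) := by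
  have hm : Measurable fun b : ℕ → ℕ => (b k : ℝ) :=
    (measurable_of_countable (fun x : ℕ => (x : ℝ))).comp (measurable_pi_apply k)
  rw [charFun_apply_real, integral_map hm.aemeasurable (by fun_prop)]
  have h := integral_eval_stepSeqLaw k fun x => Complex.exp (θ * ((x : ℝ) : ℂ) * Complex.I)
  rw [h]
  have : ((k : ℂ) + 2) ≠ 0 := by exact_mod_cast (by positivity : (k : ℝ) + 2 ≠ 0)
  simp only [Nat.cast_zero, Nat.cast_one, Complex.ofReal_zero, mul_zero, zero_mul, Complex.exp_zero,
    Complex.ofReal_one, mul_one, Complex.real_smul]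
  push_cast
  field_simp
  ring

theorem measurable_clock_real (n : ℕ) : Measurable fun b => (clock n b : ℝ) :=
  (measurable_of_countable (fun x : ℕ => (x : ℝ))).comp (measurable_clock n)

theorem charFun_map_clock (n : ℕ) (θ : ℝ) :
    charFun (stepSeqLaw.map fun b => (clock n b : ℝ)) θ =
      ∏ k ∈ Finset.range n,
        (1 + ((1 / ((k : ℝ) + 2) : ℝ) : ℂ) * (Complex.exp (θ * Complex.I) - 1)) := by
  have hind : iIndepFun (fun (k : ℕ) (b : ℕ → ℕ) => (b k : ℝ)) stepSeqLaw :=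
    iIndepFun_eval_stepSeqLaw.comp (fun _ x => (x : ℝ)) fun _ => measurable_of_countable _
  have h := iIndepFun.charFun_map_fun_finsetSum_eq_prod (P := stepSeqLaw)
    (X := fun (k : ℕ) (b : ℕ → ℕ) => (b k : ℝ)) (s := Finset.range n)
    (fun k _ => ((measurable_of_countable (fun x : ℕ => (x : ℝ))).comp
      (measurable_pi_apply k)).aemeasurable) (hind.restrict _)
  simp only [clock, Nat.cast_sum]
  rw [h, Finset.prod_apply]
  exact Finset.prod_congr rfl fun k _ => charFun_map_eval k θ

theorem charFun_map_clock_sub_div_sqrt {L : ℝ} (hL : 0 < L) (n : ℕ) (t : ℝ) :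
    charFun (stepSeqLaw.map fun b => ((clock n b : ℝ) - L) / √L) t =
      Complex.exp (-(t * √L * Complex.I))
        * charFun (stepSeqLaw.map fun b => (clock n b : ℝ)) (t / √L) := by
  have hm := measurable_clock_real n
  have hs : (√L : ℂ) ≠ 0 := by exact_mod_cast (Real.sqrt_pos.2 hL).ne'
  have hss : (√L : ℂ) * √L = L := by exact_mod_cast Real.mul_self_sqrt hL.le
  rw [charFun_apply_real, charFun_apply_real,
    integral_map ((hm.sub_const L).div_const _).aemeasurable (by fun_prop),
    integral_map hm.aemeasurable (by fun_prop), ← integral_const_mul]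
  congr 1
  ext b
  rw [← Complex.exp_add]
  congr 1
  push_cast
  field_simp
  rw [pow_two, hss]
  ring

theorem norm_exp_mul_I_sub_le {θ : ℝ} (hθ : |θ| ≤ 1) :
    ‖Complex.exp (θ * Complex.I) - 1 - θ * Complex.I + (θ : ℂ) ^ 2 / 2‖ ≤ |θ| ^ 3 := by
  have hn : ‖(θ : ℂ) * Complex.I‖ = |θ| := by simp
  have h := Complex.exp_bound (x := θ * Complex.I) (hn.trans_le hθ) (n := 3) (by norm_num)
  rw [hn] at h
  have e : Complex.exp (θ * Complex.I) - 1 - θ * Complex.I + (θ : ℂ) ^ 2 / 2 =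
      Complex.exp (θ * Complex.I)
        - ∑ m ∈ Finset.range 3, ((θ : ℂ) * Complex.I) ^ m / m.factorial := by
    simp [Finset.sum_range_succ, mul_pow, Nat.factorial]
    ring
  rw [e]
  refine h.trans (mul_le_of_le_one_right (by positivity) ?_)
  -- The constant in `Complex.exp_bound` is `4 / (3! * 3) = 2 / 9`.
  norm_num [Nat.factorial]

/-- Compare with the telescoping sum of `1 / ((k + 1) (k + 2))`; the sharper bound `1 - 1 / (n + 1)`
is what the induction needs. -/
theorem sum_one_div_add_two_sq_le_one (n : ℕ) :
    ∑ k ∈ Finset.range n, (1 / ((k : ℝ) + 2)) ^ 2 ≤ 1 := by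
  have h : ∑ k ∈ Finset.range n, (1 / ((k : ℝ) + 2)) ^ 2 ≤ 1 - 1 / ((n : ℝ) + 1) := by
    induction n with
    | zero => simp
    | succ n ih =>
      rw [Finset.sum_range_succ]
      refine (add_le_add_left ih _).trans ?_
      push_cast
      have : 1 - 1 / ((n : ℝ) + 1 + 1) - (1 - 1 / ((n : ℝ) + 1) + (1 / ((n : ℝ) + 2)) ^ 2) =
        1 / (((n : ℝ) + 1) * (n + 2) ^ 2) := by field_simp; ring
      have h2 : 0 ≤ 1 / (((n : ℝ) + 1) * (n + 2) ^ 2) := by positivity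
      linarith
  have : 0 ≤ 1 / ((n : ℝ) + 1) := by positivity
  linarith

/-- Write `L = log n`, `θ = t / √L`, `z = exp (iθ) - 1` and `m` for the clock mean. After the
Poisson comparison the exponent is `m z - i t √L = L (z - iθ) + (m - L) z`. The first term tends to
`-t ^ 2 / 2` by Taylor expansion; the second vanishes because `m - L` converges. -/
theorem tendsto_charFun_clock (t : ℝ) :
    Tendsto (fun n : ℕ => charFun
        (stepSeqLaw.map fun b => ((clock n b : ℝ) - Real.log n) / √(Real.log n)) t)
      atTop (𝓝 (Complex.exp (-(t : ℂ) ^ 2 / 2))) := by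
  let θ : ℕ → ℝ := fun n => t / √(Real.log n)
  let z : ℕ → ℂ := fun n => Complex.exp (θ n * Complex.I) - 1
  let a : ℕ → ℂ := fun n => Complex.exp (-(t * √(Real.log n) * Complex.I))
  have hθ : Tendsto θ atTop (𝓝 0) :=
    tendsto_const_nhds.div_atTop (Real.tendsto_sqrt_atTop.comp tendsto_log_natCast)
  have hz : Tendsto z atTop (𝓝 0) := by
    have h : Tendsto (fun x : ℝ => Complex.exp (x * Complex.I) - 1) (𝓝 0) (𝓝 0) := by
      have : Continuous fun x : ℝ => Complex.exp (x * Complex.I) - 1 := by fun_prop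
      simpa using this.tendsto 0
    exact h.comp hθ
  have hz1 (n : ℕ) : ‖1 + z n‖ ≤ 1 := by simp [z, Complex.norm_exp_ofReal_mul_I]
  have hLpos : ∀ᶠ n : ℕ in atTop, 0 < Real.log n := tendsto_log_natCast.eventually_gt_atTop 0
  have ha (n : ℕ) : ‖a n‖ = 1 := by
    simp only [a]
    rw [← neg_mul, ← Complex.ofReal_mul, ← Complex.ofReal_neg, Complex.norm_exp_ofReal_mul_I]
  have hθ1 : ∀ᶠ n in atTop, |θ n| ≤ 1 := by
    have := (tendsto_zero_iff_abs_tendsto_zero _).1 hθ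
    exact (this.eventually_lt_const one_pos).mono fun n h => h.le
  have hz2 : ∀ᶠ n in atTop, ‖z n‖ ≤ 1 := by
    have := hz.norm
    rw [norm_zero] at this
    exact (this.eventually_lt_const one_pos).mono fun n h => h.le
  have hTaylor : Tendsto (fun n : ℕ => ((Real.log n : ℝ) : ℂ) * (z n - θ n * Complex.I))
      atTop (𝓝 (-(t : ℂ) ^ 2 / 2)) := by
    rw [tendsto_iff_norm_sub_tendsto_zero]
    refine squeeze_zero' (g := fun n => t ^ 2 * |θ n|) (Eventually.of_forall fun n => norm_nonneg _)
      ?_ ?_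
    · filter_upwards [hLpos, hθ1] with n hL h1
      have hsq : Real.log n * θ n ^ 2 = t ^ 2 := by
        simp only [θ, div_pow, Real.sq_sqrt hL.le]
        field_simp
      have e : ((Real.log n : ℝ) : ℂ) * (z n - θ n * Complex.I) - -(t : ℂ) ^ 2 / 2 =
          ((Real.log n : ℝ) : ℂ) *
            (Complex.exp (θ n * Complex.I) - 1 - θ n * Complex.I + (θ n : ℂ) ^ 2 / 2) := by
        have : (t : ℂ) ^ 2 = ((Real.log n : ℝ) : ℂ) * (θ n : ℂ) ^ 2 := by exact_mod_cast hsq.symm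
        rw [this]
        ring
      rw [e, norm_mul, Complex.norm_real, Real.norm_of_nonneg hL.le]
      calc Real.log n * _ ≤ Real.log n * |θ n| ^ 3 := by
            gcongr
            exact norm_exp_mul_I_sub_le h1
        _ = t ^ 2 * |θ n| := by rw [← hsq, ← sq_abs (θ n)]; ring
    · simpa using ((tendsto_zero_iff_abs_tendsto_zero _).1 hθ).const_mul (t ^ 2)
  have hmean : Tendsto (fun n : ℕ => ((clockMean n - Real.log n : ℝ) : ℂ) * z n) atTop (𝓝 0) := by
    have := ((Complex.continuous_ofReal.tendsto _).comp tendsto_clockMean_sub_log).mul hz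
    rwa [mul_zero] at this
  have hexp : Tendsto (fun n => a n * Complex.exp ((clockMean n : ℂ) * z n)) atTop
      (𝓝 (Complex.exp (-(t : ℂ) ^ 2 / 2))) := by
    have := (Complex.continuous_exp.tendsto _).comp (hTaylor.add hmean)
    rw [add_zero] at this
    refine this.congr' ?_
    filter_upwards [hLpos] with n hL
    simp only [Function.comp, a]
    rw [← Complex.exp_add]
    congr 1
    have hs : Real.log n * θ n = t * √(Real.log n) := by
      have h0 : √(Real.log n) ≠ 0 := (Real.sqrt_pos.2 hL).ne'
      simp only [θ]
      field_simp
      rw [Real.sq_sqrt hL.le, mul_comm]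
    have hs' : ((Real.log n : ℝ) : ℂ) * (θ n : ℂ) = t * (√(Real.log n) : ℝ) := by
      exact_mod_cast hs
    rw [← hs']
    push_cast
    ring
  have hdiff : Tendsto (fun n => a n * (∏ k ∈ Finset.range n,
      (1 + ((1 / ((k : ℝ) + 2) : ℝ) : ℂ) * z n) - Complex.exp ((clockMean n : ℂ) * z n)))
      atTop (𝓝 0) := by
    refine squeeze_zero_norm' (a := fun n => ‖z n‖ ^ 2) ?_ ?_
    · filter_upwards [hz2] with n h2
      rw [norm_mul, ha, one_mul]
      refine (norm_prod_one_add_sub_exp_le (p := fun k : ℕ => 1 / ((k : ℝ) + 2))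
        (fun k => by positivity) (fun k => ?_) (hz1 n) h2 n).trans
        (mul_le_of_le_one_left (by positivity) (sum_one_div_add_two_sq_le_one n))
      exact (div_le_one (by positivity)).2 (by linarith [Nat.cast_nonneg (α := ℝ) k])
    · simpa using hz.norm.pow 2
  have h := hdiff.add hexp
  rw [zero_add] at h
  refine h.congr' ?_
  filter_upwards [hLpos] with n hL
  rw [charFun_map_clock_sub_div_sqrt hL, charFun_map_clock]
  simp only [a, z, θ]
  ring

/-- The central limit theorem for the clock, realised as the second coordinate of a product
space. -/
theorem tendstoInDistribution_clock {Ω : Type*} [MeasurableSpace Ω] (P : Measure Ω)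
    [IsProbabilityMeasure P] :
    TendstoInDistribution
      (fun (n : ℕ) (p : Ω × (ℕ → ℕ)) => ((clock n p.2 : ℝ) - Real.log n) / √(Real.log n))
      atTop (id : ℝ → ℝ) (fun _ => P.prod stepSeqLaw) (gaussianReal 0 1) where
  forall_aemeasurable n :=
    ((((measurable_clock_real n).sub_const _).div_const _).comp measurable_snd).aemeasurable
  tendsto := by
    refine ProbabilityMeasure.tendsto_iff_tendsto_charFun.2 fun t => ?_
    have hlim : charFun ((gaussianReal 0 1).map id) t = Complex.exp (-(t : ℂ) ^ 2 / 2) := by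
      rw [Measure.map_id, charFun_gaussianReal]
      congr 1
      simp
      ring
    have hmap (n : ℕ) : (P.prod stepSeqLaw).map
        (fun p => ((clock n p.2 : ℝ) - Real.log n) / √(Real.log n)) =
        stepSeqLaw.map fun b => ((clock n b : ℝ) - Real.log n) / √(Real.log n) := by
      have h := Measure.map_map (μ := P.prod stepSeqLaw)
        (((measurable_clock_real n).sub_const (Real.log n)).div_const √(Real.log n)) measurable_snd
      rw [(measurePreserving_snd (μ := P) (ν := stepSeqLaw)).map_eq] at h
      exact h.symm
    simp only [ProbabilityMeasure.coe_mk, hmap, hlim]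
    exact tendsto_charFun_clock t

/-! ### The enlarged filtration and the conclusion. -/

/-- The filtration on `Ω × T` generated by `ℱ` and the whole second coordinate. -/
def Filtration.prodRight {Ω T : Type*} [mΩ : MeasurableSpace Ω] [mT : MeasurableSpace T]
    (ℱ : Filtration ℕ mΩ) : Filtration ℕ (inferInstance : MeasurableSpace (Ω × T)) where
  seq n := (ℱ n).prod mT
  mono' _ _ h := sup_le_sup_right (MeasurableSpace.comap_mono (ℱ.mono h)) _
  le' n := sup_le_sup_right (MeasurableSpace.comap_mono (ℱ.le n)) _

theorem theorem2p2 {S : Type*} [MeasurableSpace S]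
    (R : Kernel S S) [IsMarkovKernel R] (U₀ : Measure S) [IsProbabilityMeasure U₀]
    -- the colours `Z n` drawn from the urn
    {ΩZ : Type*} [MeasurableSpace ΩZ] (PZ : Measure ΩZ) [IsProbabilityMeasure PZ]
    (Z : ℕ → ΩZ → S) (hZ : IsUrnColourSequence R U₀ PZ Z)
    -- the associated Markov chain `X`
    {Ω : Type u} [MeasurableSpace Ω] (P : Measure Ω) [IsProbabilityMeasure P]
    (X : ℕ → Ω → S) (hX : IsMarkovChain R U₀ P X) :
    -- an extension `π : Ω' → Ω` of the probability space of `X`, on which the times live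
    ∃ (Ω' : Type u) (mΩ' : MeasurableSpace Ω') (P' : Measure Ω')
      (_ : IsProbabilityMeasure P') (π : Ω' → Ω) (τ : ℕ → Ω' → ℕ),
      MeasurePreserving π P' P ∧
      -- the times are stopping times of a filtration for which `X` is still Markov
      (∃ 𝒢 : Filtration ℕ mΩ',
        IsMarkovChainWrt R U₀ P' 𝒢 (fun k ω => X k (π ω)) ∧
        ∀ n, IsStoppingTime 𝒢 (fun ω => ((τ n ω : ℕ) : WithTop ℕ))) ∧
      (∀ ω, τ 0 ω = 0) ∧
      (∀ ω, Monotone fun n => τ n ω) ∧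
      IndepFun (fun ω n => τ n ω) (fun ω k => X k (π ω)) P' ∧
      (∀ n, IdentDistrib (Z n) (fun ω => X (τ n ω) (π ω)) PZ P') ∧
      (∀ᵐ ω ∂P', Tendsto (fun n : ℕ => (τ n ω : ℝ) / Real.log n) atTop (𝓝 1)) ∧
      TendstoInDistribution
        (fun (n : ℕ) ω => ((τ n ω : ℝ) - Real.log n) / √(Real.log n))
        atTop (id : ℝ → ℝ) (fun _ => P') (gaussianReal 0 1) := by
  refine ⟨Ω × (ℕ → ℕ), inferInstance, P.prod stepSeqLaw, inferInstance, Prod.fst,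
    fun n p => clock n p.2, measurePreserving_fst,
    ⟨Filtration.prodRight (historyFiltration X hX.measurable),
      hX.isMarkovChainWrt_prod stepSeqLaw _ fun _ => rfl, fun n i => ?_⟩,
    fun _ => by simp [clock], fun p => monotone_clock p.2, ?_,
    hX.identDistrib_comp_clock hZ, ?_, tendstoInDistribution_clock P⟩
  -- The whole clock path is already known at time `0`, so `{τ n ≤ i}` lies in the σ-algebra at
  -- every time `i`.
  · have hm : Measurable[(Filtration.prodRight (historyFiltration X hX.measurable)) i]
        fun p : Ω × (ℕ → ℕ) => clock n p.2 :=
      (measurable_clock n).comp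
        (@measurable_snd _ _ (historyFiltration X hX.measurable i) _)
    have := hm (measurableSet_Iic (a := i))
    convert this using 1
    ext p
    simp
  · exact (indepFun_prod (μ := P) (ν := stepSeqLaw) (X := fun ω k => X k ω)
      (Y := fun b n => clock n b) (measurable_pi_lambda _ hX.measurable)
      (measurable_pi_lambda _ measurable_clock)).symm
  · exact Measure.quasiMeasurePreserving_snd.ae ae_tendsto_clock_div_log
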